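/- Let $q$ be a prime power, $\gamma\in(\mathbb{Z}/q\mathbb{Z})^{\times}$, and let $(\varepsilon_d)_{d\mid q}$ be a probability vector indexed by the positive divisors of $q$. The channel $V_{(q)}(\varepsilon_d: d\mid q)$ has input alphabet $\mathbb{Z}/q\mathbb{Z}$, output alphabet $\bigsqcup_{d\mid q}\mathbb{Z}/d\mathbb{Z}$, and on input $x$ it outputs the residue class $[x]_d$ with probability $\varepsilon_d$ for each $d \mid q$. For a channel $W$ with input alphabet $\mathbb{Z}/q\mathbb{Z}$ and finite output alphabet $\mathcal{Y}$ put $$W^0(y_1,y_2\mid u_1)=\sum_{u_2}\tfrac1q W(y_1\mid u_1+\gamma u_2)W(y_2\mid u_2),\qquad W^1(y_1,y_2,u_1\mid u_2)=\tfrac1q W(y_1\mid u_1+\gamma u_2)W(y_2\mid u_2),$$ and let $$I_\alpha(W)=\frac{\alpha}{\alpha-1}\ln\sum_{y\in\mathcal{Y}}\Big(\sum_x \tfrac1q W(y\mid x)^\alpha\Big)^{1/\alpha}\qquad(\alpha\in(0,1)\cup(1,\infty))$$ be the symmetric capacity of order $\alpha$, extended to $\alpha\in\{0,1,\infty\}$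 by its limits $$I_0(W)=\min_y\ln\frac{q}{|\{x: W(y\mid x)>0\}|},\quad I_1(W)=\sum_{x,y}\tfrac1q W(y\mid x)\ln\frac{W(y\mid x)}{\sum_{x'}\frac1q W(y\mid x')},\quad I_\infty(W)=\ln\sum_y\max_x W(y\mid x),$$ where the minimum is over the outputs $y$ that occur with positive probability. Call two channels equivalent if, for every $n\ge 0$ and every $(b_1,\dots,b_n)\in\{0,1\}^n$, the channels $(\cdots(W^{b_1})^{b_2}\cdots)^{b_n}$ obtained from them have the same $I_\alpha$ for all $\alpha\in[0,\infty]$. Let $B_1,B_2,\dots$ be independent random variables, uniform on $\{0,1\}$, and define the polarization process by $V_0=V_{(q)}(\varepsilon_d: d\mid q)$ and $V_n=V_{n-1}^{B_n}$ for $n\ge1$. Then $V_n$ converges almost surely to a random channel $V_\infty=V_{(q)}(E_{d,\infty}: d\mid q)$ with a random probability vector $(E_{d,\infty})_{d\mid q}$, in the sense that, almost surely, there are probability vectors $(E_{d,n})_{d\mid q}$ such that $V_n$ is equivalent to $V_{(q)}(E_{d,n}: d\mid q)$ for every $n\geq 0$ and $E_{d,n}\to E_{d,\infty}$ as $n\to\infty$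 for every $d\mid q$; and $$\Pr\big(\forall \alpha\in[0,\infty],\ I_\alpha(V_\infty)=\ln d\big)=\varepsilon_d\qquad\text{for every divisor } d \text{ of } q .$$ -/

import Mathlib

open MeasureTheory ProbabilityTheory Filter Topology
open scoped ENNReal

namespace Polarization

/-- A discrete memoryless channel with input alphabet `ℤ/qℤ` and a finite output alphabet:
`W.prob x y` is the transition probability `W(y | x)`. -/
structure Channel (q : ℕ) where
  /-- the output alphabet -/
  Out : Type
  [fintypeOut : Fintype Out]
  /-- the transition probabilities `W(y | x)` -/
  prob : ZMod q → Out → ℝ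
  prob_nonneg : ∀ x y, 0 ≤ prob x y
  sum_prob : ∀ x, ∑ y, prob x y = 1

attribute [instance] Channel.fintypeOut

namespace Channel

variable {q : ℕ} [NeZero q]

/-- `I_0(W) = min_y ln (q / |{x | W(y|x) > 0}|)`, the minimum being over the outputs `y` that
occur with positive probability (for the others the quotient is `q / 0 = ∞`). -/
noncomputable def symCapZero (W : Channel q) : ℝ :=
  ⨅ y : {y : W.Out // ∃ x, 0 < W.prob x y},
    Real.log ((q : ℝ) / (Nat.card {x : ZMod q // 0 < W.prob x y.1} : ℝ))

/-- `I_1(W) = I(W)`, the mutual information under the uniform input distribution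
(with `0 ln 0 = 0`). -/
noncomputable def symCapOne (W : Channel q) : ℝ :=
  ∑ y, ∑ x, (1 / (q : ℝ)) * W.prob x y *
    Real.log (W.prob x y / ∑ x', (1 / (q : ℝ)) * W.prob x' y)

/-- `I_∞(W) = ln ∑_y max_x W(y|x)`. -/
noncomputable def symCapTop (W : Channel q) : ℝ :=
  Real.log (∑ y, ⨆ x, W.prob x y)

/-- `I_α(W) = α/(α-1) ln ∑_y (∑_x (1/q) W(y|x)^α)^(1/α)` for `α ∈ (0,1) ∪ (1,∞)`. -/
noncomputable def symCapReal (W : Channel q) (a : ℝ) : ℝ :=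
  a / (a - 1) * Real.log (∑ y, (∑ x, (1 / (q : ℝ)) * W.prob x y ^ a) ^ (1 / a))

open Classical in
/-- The symmetric capacity `I_α(W)` of order `α ∈ [0,∞]`. -/
noncomputable def symCap (W : Channel q) (α : ℝ≥0∞) : ℝ :=
  if α = 0 then W.symCapZero
  else if α = 1 then W.symCapOne
  else if α = ⊤ then W.symCapTop
  else W.symCapReal α.toReal

/-- The channel `W⁰(y₁, y₂ | u₁) = ∑_{u₂} (1/q) W(y₁ | u₁ + γ u₂) W(y₂ | u₂)`. -/
noncomputable def polarZero (γ : (ZMod q)ˣ) (W : Channel q) : Channel q where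
  Out := W.Out × W.Out
  prob u₁ y := ∑ u₂ : ZMod q, (1 / (q : ℝ)) * W.prob (u₁ + γ * u₂) y.1 * W.prob u₂ y.2
  prob_nonneg u₁ y := Finset.sum_nonneg fun u₂ _ =>
    mul_nonneg (mul_nonneg (by positivity) (W.prob_nonneg _ _)) (W.prob_nonneg _ _)
  sum_prob u₁ := by
    have hq : (q : ℝ) ≠ 0 := Nat.cast_ne_zero.mpr (NeZero.ne q)
    rw [Finset.sum_comm]
    have h : ∀ u₂ : ZMod q, ∑ y : W.Out × W.Out,
        (1 / (q : ℝ)) * W.prob (u₁ + γ * u₂) y.1 * W.prob u₂ y.2 = 1 / (q : ℝ) := by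
      intro u₂
      rw [Fintype.sum_prod_type]
      simp only [← Finset.mul_sum, W.sum_prob, mul_one]
    rw [Finset.sum_congr rfl fun u₂ _ => h u₂]
    simp [ZMod.card, hq]

/-- The channel `W¹(y₁, y₂, u₁ | u₂) = (1/q) W(y₁ | u₁ + γ u₂) W(y₂ | u₂)`. -/
noncomputable def polarOne (γ : (ZMod q)ˣ) (W : Channel q) : Channel q where
  Out := W.Out × W.Out × ZMod q
  prob u₂ y := (1 / (q : ℝ)) * W.prob (y.2.2 + γ * u₂) y.1 * W.prob u₂ y.2.1
  prob_nonneg u₂ y :=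
    mul_nonneg (mul_nonneg (by positivity) (W.prob_nonneg _ _)) (W.prob_nonneg _ _)
  sum_prob u₂ := by
    have hq : (q : ℝ) ≠ 0 := Nat.cast_ne_zero.mpr (NeZero.ne q)
    rw [Fintype.sum_prod_type, Finset.sum_congr rfl fun y₁ _ => Fintype.sum_prod_type_right _,
      Finset.sum_comm]
    have h : ∀ u₁ : ZMod q, ∑ y₁ : W.Out, ∑ y₂ : W.Out,
        (1 / (q : ℝ)) * W.prob (u₁ + γ * u₂) y₁ * W.prob u₂ y₂ = 1 / (q : ℝ) := by
      intro u₁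
      simp only [← Finset.mul_sum, W.sum_prob, mul_one]
    rw [Finset.sum_congr rfl fun u₁ _ => h u₁]
    simp [ZMod.card, hq]

/-- One step of the polar transformation: `W⁰` or `W¹`. -/
noncomputable def polar (γ : (ZMod q)ˣ) (W : Channel q) (b : Fin 2) : Channel q :=
  if b = 0 then W.polarZero γ else W.polarOne γ

/-- The virtual channel `(⋯((W^{b₁})^{b₂})⋯)^{bₙ}` for the bit string `b₁ b₂ … bₙ`. The bit
strings of length `n` are the binary representations of the indices `0 ≤ i < 2 ^ n`. -/
noncomputable def virtual (γ : (ZMod q)ˣ) (W : Channel q) (bits : List (Fin 2)) : Channel q :=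
  bits.foldl (fun U b => U.polar γ b) W

/-- Two channels are equivalent if all their virtual channels, at all levels `n ≥ 0`, have the
same symmetric capacities of all orders `α ∈ [0,∞]`. -/
def Equivalent (γ : (ZMod q)ˣ) (W W' : Channel q) : Prop :=
  ∀ (bits : List (Fin 2)) (α : ℝ≥0∞),
    (W.virtual γ bits).symCap α = (W'.virtual γ bits).symCap α

/-- The polarization process driven by the bits `b 0, b 1, …`:
`V_0 = V` and `V_{n+1} = V_n ^ (b n)`. -/
noncomputable def process (γ : (ZMod q)ˣ) (V : Channel q) (b : ℕ → Fin 2) : ℕ → Channel q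
  | 0 => V
  | n + 1 => (process γ V b n).polar γ (b n)

end Channel

/-- Probability vectors `(ε_d : d ∣ q)`. -/
abbrev ProbVec (q : ℕ) : Type := stdSimplex ℝ {d : ℕ // d ∈ q.divisors}

instance instFintypeZModDivisor {q : ℕ} (d : {d : ℕ // d ∈ q.divisors}) : Fintype (ZMod d.1) :=
  haveI : NeZero d.1 := ⟨(Nat.pos_of_mem_divisors d.2).ne'⟩
  ZMod.fintype d.1

/-- The generalized erasure channel `V_(q)(ε_d : d ∣ q)`. Its output alphabet is the disjoint
union of the `ℤ/dℤ` over the divisors `d` of `q`, and on input `x` the output is the residue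
class `[x]_d` with probability `ε_d`. -/
noncomputable def erasureChannel {q : ℕ} (ε : ProbVec q) : Channel q where
  Out := Σ d : {d : ℕ // d ∈ q.divisors}, ZMod d.1
  prob x y := if y.2 = (x.val : ZMod y.1.1) then ε.1 y.1 else 0
  prob_nonneg x y := by
    split_ifs
    · exact ε.2.1 _
    · exact le_rfl
  sum_prob x := by
    rw [Fintype.sum_sigma]
    have h : ∀ d : {d : ℕ // d ∈ q.divisors},
        ∑ y : ZMod d.1, (if y = (x.val : ZMod d.1) then ε.1 d else 0) = ε.1 d := fun d => by
      rw [Finset.sum_ite_eq' Finset.univ, if_pos (Finset.mem_univ _)]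
    exact (Finset.sum_congr rfl fun d _ => h d).trans ε.2.2

/-- A sequence of channels `W n` converges to the erasure channel with parameter vector `ε`: each
`W n` is equivalent to an erasure channel whose parameter vector `e n` satisfies `e n → ε`. -/
def ConvergesTo {q : ℕ} [NeZero q] (γ : (ZMod q)ˣ) (W : ℕ → Channel q) (ε : ProbVec q) : Prop :=
  ∃ e : ℕ → ProbVec q,
    (∀ n, (W n).Equivalent γ (erasureChannel (e n))) ∧ Tendsto e atTop (𝓝 ε)

end Polarization

/-!
Every symmetric capacity of a channel `W` is determined by the sums `∑_y f(W(y | ·))` of positively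
homogeneous functions `f` over the likelihood vectors of the outputs. Channels with the same such
sums (`LikelihoodEquiv`) therefore have the same capacities (`LikelihoodEquiv.symCap_eq`), and the
relation is preserved by polar steps, since the sum for `W⁰` or `W¹` is an iterated sum over `W` of
a kernel that is homogeneous in either argument (`likelihoodSum_polar`).

An output pair of the polar transform of an erasure channel consists of residues modulo `d₁` and
`d₂`. The divisors of a prime power form a chain, and the pair is as informative as the residue of
`u₁` modulo `min d₁ d₂` for `W⁰`, and of `u₂` modulo `max d₁ d₂` for `W¹`. So the polar transform
of an erasure channel is equivalent to the erasure channel whose parameter vector is the law of the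
minimum or maximum of two independent divisors of the old law
(`likelihoodEquiv_polar_erasureChannel`).

For an upper set of divisors, the mass `t` of the parameter vector moves to `t²` or to `2t - t²`
with equal probability. Its mean is constant, and the mean of `√(t(1-t))` decays at the rate
`√3 / 2` (`sqrt_tailStep_add_le`), so that `√(t(1-t))` is almost surely summable. It bounds the
increments `t(1-t)`, hence `t` converges almost surely to `0` or `1`. Differences of upper tails
give the coordinates, so the parameter vector converges to a vertex of the simplex, which sits at
`d` with probability `ε_d` by dominated convergence (`exists_limit_vecProcess`). At the vertex `d`
all capacities equal `ln d` (`symCap_erasureChannel_of_eq_one`).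
-/

namespace Polarization

/-! ### Likelihood equivalence of channels -/

namespace Channel

variable {q : ℕ}

/-- Positive homogeneity of degree one on the nonnegative orthant. -/
def IsHomogeneous (f : (ZMod q → ℝ) → ℝ) : Prop :=
  ∀ c : ℝ, 0 ≤ c → ∀ v : ZMod q → ℝ, 0 ≤ v → f (c • v) = c * f v

/-- The sum of `f` over the likelihood vectors `W(y | ·)` of the outputs `y`. -/
noncomputable def likelihoodSum (W : Channel q) (f : (ZMod q → ℝ) → ℝ) : ℝ :=
  ∑ y, f fun x => W.prob x y

/-- Two channels are likelihood equivalent if every positively homogeneous function has the same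
sum over their likelihood vectors. This ignores null outputs and the splitting or merging of
outputs with proportional likelihood vectors. -/
def LikelihoodEquiv (W W' : Channel q) : Prop :=
  ∀ f, IsHomogeneous f → W.likelihoodSum f = W'.likelihoodSum f

lemma IsHomogeneous.likelihoodSum (W : Channel q) {g : (ZMod q → ℝ) → (ZMod q → ℝ) → ℝ}
    (hg : ∀ w, 0 ≤ w → IsHomogeneous fun v => g v w) :
    IsHomogeneous fun v => W.likelihoodSum (g v) := by
  intro c hc v hv
  simp only [Channel.likelihoodSum, Finset.mul_sum]
  exact Finset.sum_congr rfl fun y _ => hg _ (fun x => W.prob_nonneg x y) c hc v hv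

lemma LikelihoodEquiv.likelihoodSum_likelihoodSum {W W' : Channel q} (h : LikelihoodEquiv W W')
    {g : (ZMod q → ℝ) → (ZMod q → ℝ) → ℝ}
    (hg₁ : ∀ w, 0 ≤ w → IsHomogeneous fun v => g v w)
    (hg₂ : ∀ v, 0 ≤ v → IsHomogeneous (g v)) :
    (W.likelihoodSum fun v => W.likelihoodSum (g v)) =
      W'.likelihoodSum fun v => W'.likelihoodSum (g v) := by
  rw [h _ (IsHomogeneous.likelihoodSum W hg₁)]
  exact Finset.sum_congr rfl fun y _ => h _ (hg₂ _ fun x => W'.prob_nonneg x y)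

lemma isHomogeneous_iSup : IsHomogeneous fun v : ZMod q → ℝ => ⨆ x, v x := by
  intro c hc v _
  simp only [Pi.smul_apply, smul_eq_mul]
  exact (Real.mul_iSup_of_nonneg hc _).symm

lemma symCapZero_eq_sInf (W : Channel q) : W.symCapZero =
    sInf ((fun s : Set (ZMod q) => Real.log ((q : ℝ) / (Nat.card s : ℝ))) ''
      {s | s.Nonempty ∧ ∃ y, {x | 0 < W.prob x y} = s}) := by
  rw [symCapZero, iInf]
  congr 1
  ext r
  constructor
  · rintro ⟨⟨y, hy⟩, rfl⟩
    exact ⟨{x | 0 < W.prob x y}, ⟨hy, y, rfl⟩, rfl⟩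
  · rintro ⟨s, ⟨hs, y, rfl⟩, rfl⟩
    exact ⟨⟨y, hs⟩, rfl⟩

variable [NeZero q] (γ : (ZMod q)ˣ)

/-- The contribution of a pair of outputs with likelihood vectors `v` and `w` to the likelihood
sum of `f` over the channel `W⁰` or `W¹`. -/
noncomputable def polarKernel (f : (ZMod q → ℝ) → ℝ) (b : Fin 2) (v w : ZMod q → ℝ) : ℝ :=
  if b = 0 then f fun x => ∑ u : ZMod q, (1 / (q : ℝ)) * v (x + γ * u) * w u
  else ∑ u : ZMod q, f fun x => (1 / (q : ℝ)) * v (u + γ * x) * w x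

lemma likelihoodSum_polar (W : Channel q) (b : Fin 2) (f : (ZMod q → ℝ) → ℝ) :
    (W.polar γ b).likelihoodSum f =
      W.likelihoodSum fun v => W.likelihoodSum (polarKernel γ f b v) := by
  fin_cases b
  · exact Fintype.sum_prod_type (f := fun y : W.Out × W.Out =>
      f fun x => (W.polarZero γ).prob x y)
  · exact (Fintype.sum_prod_type (f := fun y : W.Out × W.Out × ZMod q =>
      f fun x => (W.polarOne γ).prob x y)).trans
        (Finset.sum_congr rfl fun y _ => Fintype.sum_prod_type _)

lemma polarKernel_homogeneous_left {f : (ZMod q → ℝ) → ℝ} (hf : IsHomogeneous f) (b : Fin 2)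
    (w : ZMod q → ℝ) (hw : 0 ≤ w) : IsHomogeneous fun v => polarKernel γ f b v w := by
  intro c hc v hv
  simp only [polarKernel]
  split_ifs
  · rw [← hf c hc _ fun x => Finset.sum_nonneg fun u _ =>
      mul_nonneg (mul_nonneg (by positivity) (hv _)) (hw _)]
    refine congrArg f (funext fun x => ?_)
    simp only [Pi.smul_apply, smul_eq_mul, Finset.mul_sum]
    exact Finset.sum_congr rfl fun u _ => by ring
  · rw [Finset.mul_sum]
    refine Finset.sum_congr rfl fun u _ => ?_
    rw [← hf c hc _ fun x => mul_nonneg (mul_nonneg (by positivity) (hv _)) (hw _)]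
    refine congrArg f (funext fun x => ?_)
    simp only [Pi.smul_apply, smul_eq_mul]
    ring

lemma polarKernel_homogeneous_right {f : (ZMod q → ℝ) → ℝ} (hf : IsHomogeneous f) (b : Fin 2)
    (v : ZMod q → ℝ) (hv : 0 ≤ v) : IsHomogeneous (polarKernel γ f b v) := by
  intro c hc w hw
  unfold polarKernel
  split_ifs
  · rw [← hf c hc _ fun x => Finset.sum_nonneg fun u _ =>
      mul_nonneg (mul_nonneg (by positivity) (hv _)) (hw _)]
    refine congrArg f (funext fun x => ?_)
    simp only [Pi.smul_apply, smul_eq_mul, Finset.mul_sum]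
    exact Finset.sum_congr rfl fun u _ => by ring
  · rw [Finset.mul_sum]
    refine Finset.sum_congr rfl fun u _ => ?_
    rw [← hf c hc _ fun x => mul_nonneg (mul_nonneg (by positivity) (hv _)) (hw _)]
    refine congrArg f (funext fun x => ?_)
    simp only [Pi.smul_apply, smul_eq_mul]
    ring

lemma LikelihoodEquiv.polar {W W' : Channel q} (h : LikelihoodEquiv W W') (b : Fin 2) :
    LikelihoodEquiv (W.polar γ b) (W'.polar γ b) := by
  intro f hf
  rw [likelihoodSum_polar, likelihoodSum_polar]
  exact h.likelihoodSum_likelihoodSum (polarKernel_homogeneous_left γ hf b)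
    (polarKernel_homogeneous_right γ hf b)

lemma LikelihoodEquiv.virtual {W W' : Channel q} (h : LikelihoodEquiv W W')
    (bits : List (Fin 2)) : LikelihoodEquiv (W.virtual γ bits) (W'.virtual γ bits) := by
  induction bits generalizing W W' with
  | nil => exact h
  | cons b bits ih => exact ih (h.polar γ b)

/-! ### Symmetric capacities as likelihood sums -/

lemma isHomogeneous_rpow {a : ℝ} (ha : 0 < a) :
    IsHomogeneous fun v : ZMod q → ℝ => (∑ x, (1 / (q : ℝ)) * v x ^ a) ^ (1 / a) := by
  intro c hc v hv
  have h : ∑ x, (1 / (q : ℝ)) * (c • v) x ^ a = c ^ a * ∑ x, (1 / (q : ℝ)) * v x ^ a := by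
    rw [Finset.mul_sum]
    refine Finset.sum_congr rfl fun x _ => ?_
    rw [Pi.smul_apply, smul_eq_mul, Real.mul_rpow hc (hv x)]
    ring
  simp only [h]
  rw [Real.mul_rpow (by positivity) (Finset.sum_nonneg fun x _ =>
      mul_nonneg (by positivity) (Real.rpow_nonneg (hv x) _)), ← Real.rpow_mul hc,
    mul_one_div_cancel ha.ne', Real.rpow_one]

lemma isHomogeneous_log : IsHomogeneous fun v : ZMod q → ℝ =>
    ∑ x, (1 / (q : ℝ)) * v x * Real.log (v x / ∑ x', (1 / (q : ℝ)) * v x') := by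
  intro c _ v _
  rcases eq_or_ne c 0 with rfl | hc
  · simp
  have h : ∑ x, (1 / (q : ℝ)) * (c * v x) = c * ∑ x, (1 / (q : ℝ)) * v x := by
    rw [Finset.mul_sum]
    exact Finset.sum_congr rfl fun x _ => by ring
  simp only [Pi.smul_apply, smul_eq_mul, h, mul_div_mul_left _ _ hc]
  rw [Finset.mul_sum]
  exact Finset.sum_congr rfl fun x _ => by ring

open Classical in
lemma isHomogeneous_support (s : Set (ZMod q)) : IsHomogeneous fun v : ZMod q → ℝ =>
    if {x | 0 < v x} = s then ∑ x, v x else 0 := by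
  intro c hc v _
  rcases hc.eq_or_lt with rfl | hc
  · simp
  simp only [Pi.smul_apply, smul_eq_mul, mul_pos_iff_of_pos_left hc]
  split_ifs <;> simp [Finset.mul_sum]

open Classical in
/-- A nonempty set is the support of some likelihood vector exactly if the homogeneous function
that adds up the entries of the vectors with that support has a nonzero likelihood sum. -/
lemma exists_support_iff (W : Channel q) {s : Set (ZMod q)} (hs : s.Nonempty) :
    (∃ y, {x | 0 < W.prob x y} = s) ↔
      W.likelihoodSum (fun v => if {x | 0 < v x} = s then ∑ x, v x else 0) ≠ 0 := by
  have hnn : ∀ y ∈ Finset.univ, 0 ≤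
      (if {x | 0 < W.prob x y} = s then ∑ x, W.prob x y else 0) := fun y _ => by
    split_ifs
    · exact Finset.sum_nonneg fun x _ => W.prob_nonneg x y
    · exact le_rfl
  rw [likelihoodSum, Ne, Finset.sum_eq_zero_iff_of_nonneg hnn]
  constructor
  · rintro ⟨y, hy⟩ h
    have h0 := h y (Finset.mem_univ _)
    rw [if_pos hy, Finset.sum_eq_zero_iff_of_nonneg fun x _ => W.prob_nonneg x y] at h0
    obtain ⟨x, hx⟩ := hs
    rw [← hy] at hx
    exact hx.ne' (h0 x (Finset.mem_univ _))
  · intro h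
    push Not at h
    obtain ⟨y, -, hy⟩ := h
    exact ⟨y, by_contra fun h' => hy (if_neg h')⟩

lemma LikelihoodEquiv.symCap_eq {W W' : Channel q} (h : LikelihoodEquiv W W') (α : ℝ≥0∞) :
    W.symCap α = W'.symCap α := by
  unfold symCap
  split_ifs with h0 h1 ht
  · rw [symCapZero_eq_sInf, symCapZero_eq_sInf]
    congr 2
    ext s
    refine and_congr_right fun hs => ?_
    rw [exists_support_iff W hs, exists_support_iff W' hs, h _ (isHomogeneous_support s)]
  · exact h _ isHomogeneous_log
  · exact congrArg Real.log (h _ isHomogeneous_iSup)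
  · have := h _ (isHomogeneous_rpow (ENNReal.toReal_pos h0 ht))
    simp only [likelihoodSum] at this
    rw [symCapReal, symCapReal, this]

lemma LikelihoodEquiv.equivalent {W W' : Channel q} (h : LikelihoodEquiv W W') :
    W.Equivalent γ W' :=
  fun bits α => (h.virtual γ bits).symCap_eq α

end Channel

/-! ### The polar transformation of probability vectors on a chain -/

section Chain

variable {ι : Type*} [LinearOrder ι]

/-- The minimum (for `b = 0`) or the maximum (for `b = 1`) of two elements. -/
def minMax (b : Fin 2) (i j : ι) : ι := if b = 0 then min i j else max i j

variable [Fintype ι]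

/-- The law of the minimum (for `b = 0`) or of the maximum (for `b = 1`) of two independent
elements of law `e`. -/
def polarVec (e : stdSimplex ℝ ι) (b : Fin 2) : stdSimplex ℝ ι where
  val k := ∑ i, ∑ j, if minMax b i j = k then e.1 i * e.1 j else 0
  property := by
    refine ⟨fun k => Finset.sum_nonneg fun i _ => Finset.sum_nonneg fun j _ => ?_, ?_⟩
    · split_ifs
      · exact mul_nonneg (e.2.1 i) (e.2.1 j)
      · exact le_rfl
    · rw [Finset.sum_comm, Finset.sum_congr rfl fun i _ => Finset.sum_comm]
      simp only [Finset.sum_ite_eq, Finset.mem_univ, if_true, ← Finset.mul_sum, e.2.2, mul_one]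

lemma sum_polarVec_mul (e : stdSimplex ℝ ι) (b : Fin 2) (g : ι → ℝ) :
    ∑ k, (polarVec e b).1 k * g k = ∑ i, ∑ j, e.1 i * e.1 j * g (minMax b i j) := by
  simp only [polarVec, Finset.sum_mul, ite_mul, zero_mul]
  rw [Finset.sum_comm, Finset.sum_congr rfl fun i _ => Finset.sum_comm]
  simp only [Finset.sum_ite_eq, Finset.mem_univ, if_true]

/-- The probability vectors obtained from `e` by the polar transformations with bits
`b 0, b 1, …`. -/
def vecProcess (e : stdSimplex ℝ ι) (b : ℕ → Fin 2) : ℕ → stdSimplex ℝ ι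
  | 0 => e
  | n + 1 => polarVec (vecProcess e b n) (b n)

end Chain

/-! ### Likelihood sums of erasure channels -/

namespace Channel

variable {q : ℕ}

open Classical in
/-- The indicator vector of the residue class of `a` modulo `d`, for a divisor `d` of `q`. -/
noncomputable def residueIndicator (d : ℕ) (a x : ZMod q) : ℝ :=
  if (d : ZMod q) ∣ x - a then 1 else 0

lemma residueIndicator_nonneg (d : ℕ) (a : ZMod q) : 0 ≤ residueIndicator d a := fun x => by
  unfold residueIndicator
  split_ifs <;> simp

/-- Two indicators agree as soon as the congruences that they test do. -/
lemma residueIndicator_congr {d : ℕ} {a a' x x' : ZMod q}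
    (h : (d : ZMod q) ∣ x - a ↔ (d : ZMod q) ∣ x' - a') :
    residueIndicator d a x = residueIndicator d a' x' := by
  unfold residueIndicator
  congr 1
  exact propext h

/-- The conjunction of two congruences, where the second is only needed under the first. -/
lemma residueIndicator_mul_congr {d₁ d₂ : ℕ} {a₁ x₁ a₂ x₂ a₃ x₃ : ZMod q}
    (h : (d₁ : ZMod q) ∣ x₁ - a₁ → ((d₂ : ZMod q) ∣ x₂ - a₂ ↔ (d₂ : ZMod q) ∣ x₃ - a₃)) :
    residueIndicator d₁ a₁ x₁ * residueIndicator d₂ a₂ x₂ =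
      residueIndicator d₁ a₁ x₁ * residueIndicator d₂ a₃ x₃ := by
  by_cases h₁ : (d₁ : ZMod q) ∣ x₁ - a₁
  · rw [residueIndicator_congr (h h₁)]
  · simp [residueIndicator, h₁]

/-- The divisors of a prime power form a chain. -/
lemma dvd_of_le_of_isPrimePow (hq : IsPrimePow q) {a b : ℕ} (ha : a ∣ q) (hb : b ∣ q)
    (hab : a ≤ b) : a ∣ b := by
  obtain ⟨p, k, hp, -, rfl⟩ := hq
  obtain ⟨i, -, rfl⟩ := (Nat.dvd_prime_pow hp.nat_prime).mp ha
  obtain ⟨j, -, rfl⟩ := (Nat.dvd_prime_pow hp.nat_prime).mp hb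
  exact pow_dvd_pow _ ((Nat.pow_le_pow_iff_right hp.nat_prime.one_lt).mp hab)

variable [NeZero q]

lemma cast_eq_cast_iff {d : ℕ} (hd : d ∣ q) (x a : ZMod q) :
    (x.val : ZMod d) = (a.val : ZMod d) ↔ (d : ZMod q) ∣ x - a := by
  have hcast : ∀ z : ZMod q, (z.val : ZMod d) = ZMod.castHom hd (ZMod d) z := fun z => by
    rw [ZMod.castHom_apply, ZMod.natCast_val]
  rw [hcast, hcast, ← sub_eq_zero, ← map_sub]
  constructor
  · intro h
    rw [← hcast, ZMod.natCast_eq_zero_iff] at h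
    rw [← ZMod.natCast_zmod_val (x - a)]
    exact Nat.cast_dvd_cast h
  · rintro ⟨c, hc⟩
    rw [hc, map_mul, map_natCast, ZMod.natCast_self, zero_mul]

lemma card_fiber_cast {d : ℕ} [NeZero d] (hd : d ∣ q) (y : ZMod d) :
    (d : ℝ) * ((Finset.univ.filter fun a : ZMod q => (a.val : ZMod d) = y).card : ℝ) = q := by
  have hcast : ∀ z : ZMod q, (z.val : ZMod d) = ZMod.castHom hd (ZMod d) z := fun z => by
    rw [ZMod.castHom_apply, ZMod.natCast_val]
  simp only [hcast]
  have hsurj := ZMod.castHom_surjective hd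
  have hfib : ∀ z : ZMod d,
      (Finset.univ.filter fun a : ZMod q => ZMod.castHom hd (ZMod d) a = z).card =
      (Finset.univ.filter fun a : ZMod q => ZMod.castHom hd (ZMod d) a = y).card := fun z =>
    AddMonoidHom.card_fiber_eq_of_mem_range (ZMod.castHom hd (ZMod d)) (hsurj z) (hsurj y)
  have h := Finset.card_eq_sum_card_fiberwise (s := (Finset.univ : Finset (ZMod q)))
    (t := (Finset.univ : Finset (ZMod d))) (f := ZMod.castHom hd (ZMod d)) (by simp)
  rw [Finset.sum_congr rfl fun z _ => hfib z] at h
  simp only [Finset.card_univ, ZMod.card, Finset.sum_const, smul_eq_mul] at h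
  exact_mod_cast h.symm

/-- Averaging over the residues modulo `d` by means of their representatives modulo `q`. -/
lemma sum_zmod_divisor {d : ℕ} [NeZero d] (hd : d ∣ q) (g : ZMod d → ℝ) :
    ∑ y, g y = (d : ℝ) / q * ∑ a : ZMod q, g (a.val : ZMod d) := by
  have hq : (q : ℝ) ≠ 0 := Nat.cast_ne_zero.mpr (NeZero.ne q)
  rw [← Finset.sum_fiberwise Finset.univ (fun a : ZMod q => (a.val : ZMod d)), Finset.mul_sum]
  refine Finset.sum_congr rfl fun y _ => ?_
  rw [Finset.sum_congr rfl fun a ha => by rw [(Finset.mem_filter.mp ha).2], Finset.sum_const,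
    nsmul_eq_mul, ← mul_assoc, div_mul_eq_mul_div, card_fiber_cast hd, div_self hq, one_mul]

lemma sum_residueIndicator {d : ℕ} (hd : d ∣ q) (a : ZMod q) :
    ∑ x, residueIndicator d a x = (q : ℝ) / d := by
  have : NeZero d := ⟨fun h => NeZero.ne q (Nat.eq_zero_of_zero_dvd (h ▸ hd))⟩
  have hd0 : (d : ℝ) ≠ 0 := Nat.cast_ne_zero.mpr (NeZero.ne d)
  rw [eq_div_iff hd0, ← card_fiber_cast hd (a.val : ZMod d), mul_comm]
  simp only [residueIndicator, ← cast_eq_cast_iff hd, Finset.sum_boole]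

/-- The likelihood sum of `f` over the channel that maps `x` to its residue class modulo `d`. -/
noncomputable def residueSum (d : ℕ) (f : (ZMod q → ℝ) → ℝ) : ℝ :=
  (d : ℝ) / q * ∑ a : ZMod q, f (residueIndicator d a)

lemma likelihoodSum_erasureChannel (ε : ProbVec q) {f : (ZMod q → ℝ) → ℝ}
    (hf : IsHomogeneous f) :
    (erasureChannel ε).likelihoodSum f = ∑ d, ε.1 d * residueSum d.1 f := by
  refine (Fintype.sum_sigma _).trans (Finset.sum_congr rfl fun d _ => ?_)
  have hd := Nat.dvd_of_mem_divisors d.2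
  have : NeZero d.1 := ⟨(Nat.pos_of_mem_divisors d.2).ne'⟩
  have h : ∀ y : ZMod d.1, f (fun x => (erasureChannel ε).prob x ⟨d, y⟩) =
      ε.1 d * f fun x => if y = (x.val : ZMod d.1) then 1 else 0 := fun y => by
    rw [← hf _ (ε.2.1 d) _ fun x => by simp only [Pi.zero_apply]; split_ifs <;> simp]
    refine congrArg f (funext fun x => ?_)
    simp [erasureChannel]
  rw [Finset.sum_congr rfl fun y _ => h y, ← Finset.mul_sum, residueSum]
  congr 1
  convert sum_zmod_divisor hd (fun y => f fun x => if y = (x.val : ZMod d.1) then 1 else 0)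
    using 5 with a a
  unfold residueIndicator
  congr 1
  exact propext ((cast_eq_cast_iff hd _ _).symm.trans eq_comm)

/-! ### The polar transformation of erasure channels -/

variable (γ : (ZMod q)ˣ) {f : (ZMod q → ℝ) → ℝ}

/-- Over `W⁰`, residues modulo `d₁` and `d₂`, one dividing the other, give the residue of `u₁`
modulo the smaller divisor. -/
lemma residueSum_polarKernel_zero (hf : IsHomogeneous f) {d₁ d₂ d : ℕ} (hd₁ : d₁ ∣ q)
    (hd₂ : d₂ ∣ q) (h : d₁ ∣ d₂ ∧ d = d₁ ∨ d₂ ∣ d₁ ∧ d = d₂) :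
    residueSum d₁ (fun v => residueSum d₂ (polarKernel γ f 0 v)) = residueSum d f := by
  have hq : (q : ℝ) ≠ 0 := Nat.cast_ne_zero.mpr (NeZero.ne q)
  have hpos : ∀ {k : ℕ}, k ∣ q → (k : ℝ) ≠ 0 := fun hk =>
    Nat.cast_ne_zero.mpr fun h0 => NeZero.ne q (Nat.eq_zero_of_zero_dvd (h0 ▸ hk))
  have hd₁' := hpos hd₁
  have hd₂' := hpos hd₂
  have hd' : (d : ℝ) ≠ 0 := by rcases h with ⟨-, rfl⟩ | ⟨-, rfl⟩ <;> assumption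
  have key : ∀ a₁ a₂ : ZMod q,
      polarKernel γ f 0 (residueIndicator d₁ a₁) (residueIndicator d₂ a₂) =
        (d : ℝ) / (d₁ * d₂) * f (residueIndicator d (a₁ - γ * a₂)) := fun a₁ a₂ => by
    rw [← hf _ (by positivity) _ (residueIndicator_nonneg _ _), polarKernel, if_pos rfl]
    refine congrArg f (funext fun x => ?_)
    simp only [Pi.smul_apply, smul_eq_mul, mul_assoc]
    rw [← Finset.mul_sum]
    rcases h with ⟨h, rfl⟩ | ⟨h, rfl⟩
    · have hprod : ∀ u : ZMod q, residueIndicator d a₁ (x + γ * u) * residueIndicator d₂ a₂ u =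
          residueIndicator d₂ a₂ u * residueIndicator d (a₁ - γ.1 * a₂) x := fun u => by
        rw [mul_comm]
        refine residueIndicator_mul_congr fun hu => ?_
        have hu' : (d : ZMod q) ∣ γ * (u - a₂) :=
          ((Nat.cast_dvd_cast h).trans hu).mul_left _
        rw [← dvd_sub_left hu']
        ring_nf
      rw [Finset.sum_congr rfl fun u _ => hprod u, ← Finset.sum_mul, sum_residueIndicator hd₂]
      field_simp
    · have hbij : ∀ u : ZMod q, residueIndicator d₁ a₁ (x + γ * u) =
          residueIndicator d₁ (γ⁻¹.1 * (a₁ - x)) u := fun u => residueIndicator_congr <| by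
        rw [← γ.isUnit.dvd_mul_left (b := u - _), mul_sub, Units.mul_inv_cancel_left γ]
        ring_nf
      have hprod : ∀ u : ZMod q, residueIndicator d₁ a₁ (x + γ * u) * residueIndicator d a₂ u =
          residueIndicator d₁ (γ⁻¹.1 * (a₁ - x)) u * residueIndicator d (a₁ - γ.1 * a₂) x :=
        fun u => by
        rw [← hbij]
        refine residueIndicator_mul_congr fun hu => ?_
        have hu' := (Nat.cast_dvd_cast (α := ZMod q) h).trans hu
        rw [← γ.isUnit.dvd_mul_left (b := u - _), ← dvd_sub_right hu']
        ring_nf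
      rw [Finset.sum_congr rfl fun u _ => hprod u, ← Finset.sum_mul, sum_residueIndicator hd₁]
      field_simp
  simp only [residueSum, key, ← Finset.mul_sum]
  have hshift : ∀ a₂ : ZMod q, ∑ a₁, f (residueIndicator d (a₁ - γ * a₂)) =
      ∑ a, f (residueIndicator d a) := fun a₂ =>
    (Equiv.subRight (γ * a₂ : ZMod q)).sum_comp fun a => f (residueIndicator d a)
  rw [Finset.sum_comm, Finset.sum_congr rfl fun a₂ _ => hshift a₂, Finset.sum_const,
    Finset.card_univ, ZMod.card, nsmul_eq_mul]
  field_simp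

/-- Over `W¹`, residues modulo `d₁` and `d₂`, one dividing the other, give the residue of `u₂`
modulo the larger divisor. -/
lemma residueSum_polarKernel_one (hf : IsHomogeneous f) {d₁ d₂ d : ℕ} (hd₁ : d₁ ∣ q)
    (hd₂ : d₂ ∣ q) (h : d₁ ∣ d₂ ∧ d = d₂ ∨ d₂ ∣ d₁ ∧ d = d₁) :
    residueSum d₁ (fun v => residueSum d₂ (polarKernel γ f 1 v)) = residueSum d f := by
  have hq : (q : ℝ) ≠ 0 := Nat.cast_ne_zero.mpr (NeZero.ne q)
  have hpos : ∀ {k : ℕ}, k ∣ q → (k : ℝ) ≠ 0 := fun hk =>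
    Nat.cast_ne_zero.mpr fun h0 => NeZero.ne q (Nat.eq_zero_of_zero_dvd (h0 ▸ hk))
  have hd₁' := hpos hd₁
  have hd₂' := hpos hd₂
  have hnn : ∀ k (a b : ZMod q), 0 ≤ residueIndicator k a b := fun k a b =>
    residueIndicator_nonneg k a b
  have key : ∀ a₁ a₂ u : ZMod q,
      f (fun x => 1 / (q : ℝ) * residueIndicator d₁ a₁ (u + γ * x) * residueIndicator d₂ a₂ x) =
      1 / (q : ℝ) * f (fun x => residueIndicator d₁ (γ⁻¹.1 * (a₁ - u)) x *
        residueIndicator d₂ a₂ x) := fun a₁ a₂ u => by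
    rw [← hf _ (by positivity) _ fun x => mul_nonneg (hnn _ _ _) (hnn _ _ _)]
    refine congrArg f (funext fun x => ?_)
    simp only [Pi.smul_apply, smul_eq_mul, mul_assoc]
    congr 2
    refine residueIndicator_congr ?_
    rw [← γ.isUnit.dvd_mul_left (b := x - _), mul_sub, Units.mul_inv_cancel_left γ]
    ring_nf
  have hshift : ∀ (g : ZMod q → ℝ) (a₁ : ZMod q), ∑ u, g (γ⁻¹.1 * (a₁ - u)) = ∑ b, g b :=
    fun g a₁ => ((Equiv.subLeft a₁).trans (Units.mulLeft γ⁻¹)).sum_comp g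
  simp only [residueSum, polarKernel, one_ne_zero, if_false, key, ← Finset.mul_sum]
  rw [Finset.sum_congr rfl fun a₁ _ => (Finset.sum_congr rfl fun a₂ _ =>
    (hshift (fun b => f fun x =>
      residueIndicator d₁ b x * residueIndicator d₂ a₂ x) a₁)), Finset.sum_const, Finset.card_univ, ZMod.card, nsmul_eq_mul]
  rcases h with ⟨h, rfl⟩ | ⟨h, rfl⟩
  · have hprod : ∀ a₂ b : ZMod q, f (fun x => residueIndicator d₁ b x * residueIndicator d a₂ x) =
        residueIndicator d₁ a₂ b * f (residueIndicator d a₂) := fun a₂ b => by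
      rw [← hf _ (hnn _ _ _) _ (residueIndicator_nonneg _ _)]
      refine congrArg f (funext fun x => ?_)
      rw [mul_comm, residueIndicator_mul_congr (a₃ := a₂) (x₃ := b) fun hx => ?_, mul_comm]
      · rfl
      · rw [← dvd_sub_right (c := x - _) ((Nat.cast_dvd_cast (α := ZMod q) h).trans hx),
          sub_sub_sub_cancel_left]
    simp only [hprod, ← Finset.sum_mul, sum_residueIndicator hd₁, ← Finset.mul_sum]
    field_simp
  · have hprod : ∀ a₂ b : ZMod q, f (fun x => residueIndicator d b x * residueIndicator d₂ a₂ x) =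
        residueIndicator d₂ b a₂ * f (residueIndicator d b) := fun a₂ b => by
      rw [← hf _ (hnn _ _ _) _ (residueIndicator_nonneg _ _)]
      refine congrArg f (funext fun x => ?_)
      rw [residueIndicator_mul_congr (a₃ := b) (x₃ := a₂) fun hx => ?_, mul_comm]
      · rfl
      · rw [← dvd_sub_right (c := x - _) ((Nat.cast_dvd_cast (α := ZMod q) h).trans hx),
          sub_sub_sub_cancel_left]
    rw [Finset.sum_comm]
    simp only [hprod, ← Finset.sum_mul, sum_residueIndicator hd₂, ← Finset.mul_sum]
    field_simp

/-- One polar step maps an erasure channel to an erasure channel, up to equivalence. -/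
lemma likelihoodEquiv_polar_erasureChannel (hq : IsPrimePow q) (ε : ProbVec q) (b : Fin 2) :
    LikelihoodEquiv ((erasureChannel ε).polar γ b) (erasureChannel (polarVec ε b)) := by
  intro f hf
  rw [likelihoodSum_polar, likelihoodSum_erasureChannel _ hf,
    sum_polarVec_mul ε b fun d => residueSum d.1 f, likelihoodSum_erasureChannel _
      (IsHomogeneous.likelihoodSum _ (polarKernel_homogeneous_left γ hf b))]
  refine Finset.sum_congr rfl fun d₁ _ => ?_
  have hd₁ := Nat.dvd_of_mem_divisors d₁.2
  have h : ∀ a : ZMod q,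
      (erasureChannel ε).likelihoodSum (polarKernel γ f b (residueIndicator d₁.1 a)) =
      ∑ d₂, ε.1 d₂ * residueSum d₂.1 (polarKernel γ f b (residueIndicator d₁.1 a)) := fun a =>
    likelihoodSum_erasureChannel _
      (polarKernel_homogeneous_right γ hf b _ (residueIndicator_nonneg _ _))
  rw [residueSum, Finset.sum_congr rfl fun a _ => h a, Finset.sum_comm, Finset.mul_sum,
    Finset.mul_sum]
  refine Finset.sum_congr rfl fun d₂ _ => ?_
  have hd₂ := Nat.dvd_of_mem_divisors d₂.2
  have hstep : residueSum d₁.1 (fun v => residueSum d₂.1 (polarKernel γ f b v)) =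
      residueSum (minMax b d₁ d₂).1 f := by
    have hle : d₁ ≤ d₂ → d₁.1 ∣ d₂.1 := dvd_of_le_of_isPrimePow hq hd₁ hd₂
    have hge : d₂ ≤ d₁ → d₂.1 ∣ d₁.1 := dvd_of_le_of_isPrimePow hq hd₂ hd₁
    fin_cases b
    · refine residueSum_polarKernel_zero γ hf hd₁ hd₂ ?_
      rcases le_total d₁ d₂ with h | h
      · exact Or.inl ⟨hle h, congrArg Subtype.val (min_eq_left h)⟩
      · exact Or.inr ⟨hge h, congrArg Subtype.val (min_eq_right h)⟩
    · refine residueSum_polarKernel_one γ hf hd₁ hd₂ ?_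
      rcases le_total d₁ d₂ with h | h
      · exact Or.inl ⟨hle h, congrArg Subtype.val (max_eq_right h)⟩
      · exact Or.inr ⟨hge h, congrArg Subtype.val (max_eq_left h)⟩
  rw [← hstep, residueSum]
  simp only [← Finset.mul_sum]
  ring

lemma likelihoodEquiv_process (hq : IsPrimePow q) (ε : ProbVec q) (b : ℕ → Fin 2) (n : ℕ) :
    LikelihoodEquiv (process γ (erasureChannel ε) b n) (erasureChannel (vecProcess ε b n)) := by
  induction n with
  | zero => exact fun f _ => rfl
  | succ n ih =>
    intro f hf
    exact (ih.polar γ (b n) f hf).trans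
      (likelihoodEquiv_polar_erasureChannel γ hq _ (b n) f hf)

/-! ### The capacities of a pure residue channel -/

lemma sum_residueIndicator_div {d : ℕ} (hd : d ∣ q) (a : ZMod q) :
    ∑ x, 1 / (q : ℝ) * residueIndicator d a x = 1 / d := by
  have hq : (q : ℝ) ≠ 0 := Nat.cast_ne_zero.mpr (NeZero.ne q)
  rw [← Finset.mul_sum, sum_residueIndicator hd]
  field_simp

open Classical in
/-- The channel that always outputs the residue class modulo `d` has all its symmetric
capacities equal to `ln d`. -/
lemma symCap_erasureChannel_of_eq_one (ε : ProbVec q) (d : {d : ℕ // d ∈ q.divisors})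
    (hε : ε.1 d = 1) (α : ℝ≥0∞) : (erasureChannel ε).symCap α = Real.log (d : ℕ) := by
  have hd := Nat.dvd_of_mem_divisors d.2
  have hd0 : (0 : ℝ) < d.1 := Nat.cast_pos.mpr (Nat.pos_of_mem_divisors d.2)
  have hq : (q : ℝ) ≠ 0 := Nat.cast_ne_zero.mpr (NeZero.ne q)
  have hε0 : ∀ d', d' ≠ d → ε.1 d' = 0 := fun d' hd' => by
    have h := ε.2.2
    rw [← Finset.add_sum_erase _ _ (Finset.mem_univ d), hε, add_eq_left,
      Finset.sum_eq_zero_iff_of_nonneg fun i _ => ε.2.1 i] at h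
    exact h d' (Finset.mem_erase.mpr ⟨hd', Finset.mem_univ _⟩)
  -- A function with the constant value `c` on the residue indicators has likelihood sum `d * c`.
  have hsum : ∀ f : (ZMod q → ℝ) → ℝ, IsHomogeneous f → ∀ c : ℝ,
      (∀ a, f (residueIndicator d.1 a) = c) → (erasureChannel ε).likelihoodSum f = d.1 * c := by
    intro f hf c hc
    rw [likelihoodSum_erasureChannel ε hf, Finset.sum_eq_single d
      (fun d' _ hd' => by rw [hε0 d' hd', zero_mul]) (by simp), hε, one_mul, residueSum,
      Finset.sum_congr rfl fun a _ => hc a, Finset.sum_const, Finset.card_univ, ZMod.card,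
      nsmul_eq_mul]
    field_simp
  unfold symCap
  split_ifs with h0 h1 ht
  · have hval : ∀ y : {y : (erasureChannel ε).Out // ∃ x, 0 < (erasureChannel ε).prob x y},
        Real.log ((q : ℝ) / (Nat.card {x : ZMod q // 0 < (erasureChannel ε).prob x y.1} : ℝ)) =
          Real.log d.1 := by
      rintro ⟨⟨d', y⟩, x, hx⟩
      have hdd : d' = d := by_contra fun h => by
        simp [erasureChannel, hε0 d' h] at hx
      subst hdd
      have hiff : ∀ x, 0 < (erasureChannel ε).prob x ⟨d', y⟩ ↔ (x.val : ZMod d'.1) = y := by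
        intro x
        simp only [erasureChannel, hε, eq_comm (a := y)]
        split_ifs with h
        · simp only [h, zero_lt_one]
        · simp only [h, lt_irrefl]
      have : NeZero d'.1 := ⟨(Nat.pos_of_mem_divisors d'.2).ne'⟩
      have hc := card_fiber_cast hd y
      simp only [hiff]
      rw [Nat.card_eq_fintype_card, Fintype.card_subtype]
      have hne : ((Finset.univ.filter fun a : ZMod q => (a.val : ZMod d'.1) = y).card : ℝ) ≠ 0 :=
        fun h => hq (by rw [← hc, h, mul_zero])
      congr 1
      rw [div_eq_iff hne]
      exact hc.symm
    have : Nonempty {y : (erasureChannel ε).Out // ∃ x, 0 < (erasureChannel ε).prob x y} :=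
      ⟨⟨⟨d, ((0 : ZMod q).val : ZMod d.1)⟩, 0, by simp [erasureChannel, hε]⟩⟩
    rw [symCapZero, iInf_congr hval, ciInf_const]
  · refine (hsum _ isHomogeneous_log (1 / d.1 * Real.log d.1) fun a => ?_).trans (by field_simp)
    rw [sum_residueIndicator_div hd]
    refine (Finset.sum_congr rfl fun x _ => ?_).trans
      ((Finset.sum_mul Finset.univ (fun x => 1 / (q : ℝ) * residueIndicator d.1 a x)
        (Real.log d.1)).symm.trans (by rw [sum_residueIndicator_div hd]))
    unfold residueIndicator
    split_ifs <;> simp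
  · refine congrArg Real.log ((hsum _ isHomogeneous_iSup 1 fun a => ?_).trans (mul_one _))
    refine le_antisymm (ciSup_le fun x => ?_) ((?_ : (1 : ℝ) ≤ _).trans
      (le_ciSup (f := residueIndicator d.1 a) (Set.finite_range _).bddAbove a))
    · unfold residueIndicator
      split_ifs <;> simp
    · simp [residueIndicator]
  · have hα : 0 < α.toReal := ENNReal.toReal_pos h0 ht
    have hα1 : α.toReal - 1 ≠ 0 := fun h =>
      h1 ((ENNReal.toReal_eq_one_iff α).mp (sub_eq_zero.mp h))
    have h := hsum _ (isHomogeneous_rpow hα) ((1 / (d.1 : ℝ)) ^ (1 / α.toReal)) fun a => by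
      rw [← sum_residueIndicator_div hd a]
      congr 1
      refine Finset.sum_congr rfl fun x _ => ?_
      unfold residueIndicator
      split_ifs <;> simp [hα.ne']
    rw [likelihoodSum] at h
    rw [symCapReal, h, Real.log_mul hd0.ne' (by positivity), Real.log_rpow (by positivity),
      one_div (d.1 : ℝ), Real.log_inv]
    field_simp
    ring

end Channel

/-! ### The scalar recursion of the upper tails -/

/-- The erasure recursion `t ↦ t²` (for `b = 0`) or `t ↦ 2t - t²` (for `b = 1`). -/
def tailStep (b : Fin 2) (t : ℝ) : ℝ := if b = 0 then t ^ 2 else 2 * t - t ^ 2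

/-- The orbit of `t` under the erasure recursion with bits `b 0, b 1, …`. -/
def tailProcess (t : ℝ) (b : ℕ → Fin 2) : ℕ → ℝ
  | 0 => t
  | n + 1 => tailStep (b n) (tailProcess t b n)

lemma tailStep_mem_Icc (b : Fin 2) {t : ℝ} (ht : t ∈ Set.Icc (0 : ℝ) 1) :
    tailStep b t ∈ Set.Icc (0 : ℝ) 1 := by
  obtain ⟨h0, h1⟩ := ht
  unfold tailStep
  split_ifs <;> constructor <;> nlinarith

lemma tailProcess_mem_Icc {t : ℝ} (ht : t ∈ Set.Icc (0 : ℝ) 1) (b : ℕ → Fin 2) (n : ℕ) :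
    tailProcess t b n ∈ Set.Icc (0 : ℝ) 1 := by
  induction n with
  | zero => exact ht
  | succ n ih => exact tailStep_mem_Icc _ ih

lemma tailProcess_congr (t : ℝ) {b b' : ℕ → Fin 2} {n : ℕ} (h : ∀ i < n, b i = b' i) :
    tailProcess t b n = tailProcess t b' n := by
  induction n with
  | zero => rfl
  | succ n ih =>
    rw [tailProcess, tailProcess, ih fun i hi => h i (hi.trans n.lt_succ_self),
      h n n.lt_succ_self]

section Chain

variable {ι : Type*} [Fintype ι]

lemma sum_mem_Icc (e : stdSimplex ℝ ι) (s : Finset ι) : ∑ i ∈ s, e.1 i ∈ Set.Icc (0 : ℝ) 1 :=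
  ⟨Finset.sum_nonneg fun i _ => e.2.1 i,
    (Finset.sum_le_univ_sum_of_nonneg e.2.1).trans_eq e.2.2⟩

variable [LinearOrder ι]

/-- In a chain, a minimum lies in an upper set if both elements do, and a maximum if one of them
does. -/
lemma sum_polarVec_of_isUpperSet (e : stdSimplex ℝ ι) (b : Fin 2) {s : Finset ι}
    (hs : IsUpperSet (s : Set ι)) :
    ∑ i ∈ s, (polarVec e b).1 i = tailStep b (∑ i ∈ s, e.1 i) := by
  have hind : ∀ e : stdSimplex ℝ ι, ∑ i ∈ s, e.1 i = ∑ i, e.1 i * if i ∈ s then 1 else 0 :=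
    fun e => by simp [Finset.sum_ite_mem]
  have hup : ∀ {i j}, i ≤ j → i ∈ s → j ∈ s := fun hij hi => hs hij hi
  rw [hind, sum_polarVec_mul, tailStep]
  have hsq : (∑ i ∈ s, e.1 i) ^ 2 = ∑ i, ∑ j, e.1 i * e.1 j *
      ((if i ∈ s then 1 else 0) * if j ∈ s then 1 else 0) := by
    rw [hind, sq, Finset.sum_mul_sum]
    exact Finset.sum_congr rfl fun i _ => Finset.sum_congr rfl fun j _ => by ring
  split_ifs with hb
  · rw [hsq]
    refine Finset.sum_congr rfl fun i _ => Finset.sum_congr rfl fun j _ => ?_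
    congr 1
    rw [minMax, if_pos hb]
    rcases le_total i j with h | h <;> have := hup h <;> simp only [h, min_eq_left, min_eq_right] <;>
      split_ifs <;> simp_all
  · have hlin : 2 * ∑ i ∈ s, e.1 i = ∑ i, ∑ j, e.1 i * e.1 j *
        ((if i ∈ s then 1 else 0) + if j ∈ s then 1 else 0) := by
      simp only [mul_add, Finset.sum_add_distrib]
      rw [Finset.sum_comm (f := fun i j => e.1 i * e.1 j * if j ∈ s then (1 : ℝ) else 0), two_mul,
        hind]
      congr 1 <;> refine Finset.sum_congr rfl fun i _ => ?_
      · rw [← Finset.sum_mul, ← Finset.mul_sum, e.2.2, mul_one]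
      · rw [← Finset.sum_mul, ← Finset.sum_mul, e.2.2, one_mul]
    rw [hsq, hlin, ← Finset.sum_sub_distrib]
    refine Finset.sum_congr rfl fun i _ => ?_
    rw [← Finset.sum_sub_distrib]
    refine Finset.sum_congr rfl fun j _ => ?_
    rw [← mul_sub]
    congr 1
    rw [minMax, if_neg hb]
    rcases le_total i j with h | h <;> have := hup h <;> simp only [h, max_eq_left, max_eq_right] <;>
      split_ifs <;> simp_all

lemma sum_vecProcess_of_isUpperSet (e : stdSimplex ℝ ι) (b : ℕ → Fin 2) (n : ℕ) {s : Finset ι}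
    (hs : IsUpperSet (s : Set ι)) :
    ∑ i ∈ s, (vecProcess e b n).1 i = tailProcess (∑ i ∈ s, e.1 i) b n := by
  induction n with
  | zero => rfl
  | succ n ih => rw [vecProcess, sum_polarVec_of_isUpperSet _ _ hs, ih, tailProcess]

open Classical in
/-- A coordinate is the difference of the tails from `i` on and beyond `i`. -/
lemma vecProcess_apply (e : stdSimplex ℝ ι) (b : ℕ → Fin 2) (n : ℕ) (i : ι) :
    (vecProcess e b n).1 i = tailProcess (∑ j with i ≤ j, e.1 j) b n -
      tailProcess (∑ j with i < j, e.1 j) b n := by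
  rw [← sum_vecProcess_of_isUpperSet e b n (s := Finset.univ.filter (i ≤ ·))
      fun _ _ h hi => by simpa using (by simpa using hi : i ≤ _).trans h,
    ← sum_vecProcess_of_isUpperSet e b n (s := Finset.univ.filter (i < ·))
      fun _ _ h hi => by simpa using (by simpa using hi : i < _).trans_le h]
  have h : Finset.univ.filter (i ≤ ·) = insert i (Finset.univ.filter (i < ·)) := by
    ext j
    simp [le_iff_eq_or_lt, eq_comm]
  rw [h, Finset.sum_insert (by simp), add_sub_cancel_right]

end Chain

/-! ### Polarization of the scalar recursion -/

/-- The average of `√(t(1-t))` over both branches of the recursion contracts by `√3 / 2`. -/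
lemma sqrt_tailStep_add_le {t : ℝ} (ht : t ∈ Set.Icc (0 : ℝ) 1) :
    √(tailStep 0 t * (1 - tailStep 0 t)) + √(tailStep 1 t * (1 - tailStep 1 t)) ≤
      √3 * √(t * (1 - t)) := by
  obtain ⟨h0, h1⟩ := ht
  have hz : 0 ≤ t * (1 - t) := mul_nonneg h0 (by linarith)
  have ha : 0 ≤ t * (1 + t) := by positivity
  have hb : 0 ≤ (1 - t) * (2 - t) := mul_nonneg (by linarith) (by linarith)
  have e0 : tailStep 0 t * (1 - tailStep 0 t) = t * (1 - t) * (t * (1 + t)) := by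
    simp only [tailStep, if_true]; ring
  have e1 : tailStep 1 t * (1 - tailStep 1 t) = t * (1 - t) * ((1 - t) * (2 - t)) := by
    simp only [tailStep, one_ne_zero, if_false]; ring
  rw [e0, e1, Real.sqrt_mul hz, Real.sqrt_mul hz, ← mul_add, mul_comm]
  refine mul_le_mul_of_nonneg_right (Real.le_sqrt_of_sq_le ?_) (Real.sqrt_nonneg _)
  -- With `u = t(1-t) ≤ 1/4` the square is `2 - 2u + 2√(u(2+u))`, and `u(2+u) ≤ (1/2 + u)²`.
  have hprod : √(t * (1 + t)) * √((1 - t) * (2 - t)) ≤ 1 / 2 + t * (1 - t) := by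
    rw [← Real.sqrt_mul ha]
    refine Real.sqrt_le_iff.mpr ⟨by linarith, ?_⟩
    nlinarith [sq_nonneg (t - 1 / 2)]
  nlinarith [Real.sq_sqrt ha, Real.sq_sqrt hb]

lemma tendsto_tailProcess_of_summable {t : ℝ} (ht : t ∈ Set.Icc (0 : ℝ) 1) (b : ℕ → Fin 2)
    (h : Summable fun n => √(tailProcess t b n * (1 - tailProcess t b n))) :
    ∃ l : ℝ, (l = 0 ∨ l = 1) ∧ Tendsto (tailProcess t b) atTop (𝓝 l) := by
  have hmem := tailProcess_mem_Icc ht b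
  have hdist : ∀ n, dist (tailProcess t b n) (tailProcess t b n.succ) ≤
      √(tailProcess t b n * (1 - tailProcess t b n)) := fun n => by
    obtain ⟨h0, h1⟩ := hmem n
    set x := tailProcess t b n
    have hz : 0 ≤ x * (1 - x) := mul_nonneg h0 (by linarith)
    have hd : dist x (tailProcess t b n.succ) = x * (1 - x) := by
      rw [Real.dist_eq, tailProcess, tailStep]
      split_ifs
      · rw [← abs_of_nonneg hz]; congr 1; ring
      · rw [← abs_of_nonneg hz, ← abs_neg]; congr 1; ring
    rw [hd]
    exact Real.le_sqrt_of_sq_le (by nlinarith [mul_le_mul_of_nonneg_left h1 h0])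
  obtain ⟨l, hl⟩ := cauchySeq_tendsto_of_complete
    (cauchySeq_of_summable_dist (Summable.of_nonneg_of_le (fun _ => dist_nonneg) hdist h))
  refine ⟨l, ?_, hl⟩
  have h1 : Tendsto (fun n => √(tailProcess t b n * (1 - tailProcess t b n))) atTop
      (𝓝 √(l * (1 - l))) := (hl.mul (tendsto_const_nhds.sub hl)).sqrt
  have h2 := tendsto_nhds_unique h1 h.tendsto_atTop_zero
  have hl01 : l ∈ Set.Icc (0 : ℝ) 1 := isClosed_Icc.mem_of_tendsto hl (Eventually.of_forall hmem)
  rw [Real.sqrt_eq_zero (mul_nonneg hl01.1 (by linarith [hl01.2])), mul_eq_zero] at h2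
  exact h2.imp id fun h => by linarith

section Probability

variable {Ω : Type*} [MeasurableSpace Ω] {P : Measure Ω} {B : ℕ → Ω → Fin 2}

lemma measurable_tailStep (b : Fin 2) : Measurable (tailStep b) := by
  unfold tailStep
  split_ifs <;> fun_prop

lemma measurable_tailProcess (hBmeas : ∀ n, Measurable (B n)) (t : ℝ) (n : ℕ) :
    Measurable fun ω => tailProcess t (fun k => B k ω) n := by
  induction n with
  | zero => exact measurable_const
  | succ n ih =>
    have h : Measurable fun p : Fin 2 × ℝ => tailStep p.1 p.2 :=
      measurable_from_prod_countable_right measurable_tailStep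
    exact h.comp ((hBmeas n).prodMk ih)

lemma indepFun_tailProcess (hBmeas : ∀ n, Measurable (B n)) (hBindep : iIndepFun B P) (t : ℝ)
    (n : ℕ) : IndepFun (B n) (fun ω => tailProcess t (fun k => B k ω) n) P := by
  have h := hBindep.indepFun_finset {n} (Finset.range n) (by simp) hBmeas
  have h' := h.comp (φ := fun v => v ⟨n, Finset.mem_singleton_self n⟩)
    (ψ := fun v : Finset.range n → Fin 2 =>
      tailProcess t (fun k => if hk : k ∈ Finset.range n then v ⟨k, hk⟩ else 0) n)
    (measurable_of_countable _) (measurable_of_countable _)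
  refine h'.congr .rfl (.of_forall fun ω => ?_)
  exact tailProcess_congr t fun i hi => by simp [hi]

variable [IsProbabilityMeasure P]

/-- The law of the next tail is the even mixture of the two branches. -/
lemma integral_tailProcess_succ (hBmeas : ∀ n, Measurable (B n)) (hBindep : iIndepFun B P)
    (hBfair : ∀ n b, P {ω | B n ω = b} = 1 / 2) {t : ℝ} (ht : t ∈ Set.Icc (0 : ℝ) 1)
    {g : ℝ → ℝ} (hg : Measurable g) {C : ℝ} (hC : ∀ x ∈ Set.Icc (0 : ℝ) 1, ‖g x‖ ≤ C) (n : ℕ) :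
    ∫ ω, g (tailProcess t (fun k => B k ω) (n + 1)) ∂P =
      1 / 2 * ∫ ω, (g (tailStep 0 (tailProcess t (fun k => B k ω) n)) +
        g (tailStep 1 (tailProcess t (fun k => B k ω) n))) ∂P := by
  have hX := measurable_tailProcess hBmeas t n
  have hmeas : ∀ b, Measurable fun ω => g (tailStep b (tailProcess t (fun k => B k ω) n)) :=
    fun b => hg.comp ((measurable_tailStep b).comp hX)
  have hbound : ∀ b ω, ‖g (tailStep b (tailProcess t (fun k => B k ω) n))‖ ≤ C := fun b ω =>
    hC _ (tailStep_mem_Icc b (tailProcess_mem_Icc ht _ n))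
  have hint : ∀ b, Integrable (fun ω => g (tailStep b (tailProcess t (fun k => B k ω) n))) P :=
    fun b => Integrable.of_bound (hmeas b).aestronglyMeasurable C (.of_forall (hbound b))
  let χ : Fin 2 → Ω → ℝ := fun b ω => if B n ω = b then 1 else 0
  have hset : ∀ b, MeasurableSet {ω | B n ω = b} := fun b => hBmeas n (measurableSet_singleton b)
  have hχmeas : ∀ b, Measurable (χ b) := fun b =>
    Measurable.ite (hset b) measurable_const measurable_const
  have hχint : ∀ b, ∫ ω, χ b ω ∂P = 1 / 2 := fun b => by
    have h : χ b = {ω | B n ω = b}.indicator 1 := by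
      funext ω
      simp [χ, Set.indicator]
    rw [h, integral_indicator_one (hset b), measureReal_def, hBfair]
    simp
  have hprod : ∀ b, ∫ ω, χ b ω * g (tailStep b (tailProcess t (fun k => B k ω) n)) ∂P =
      1 / 2 * ∫ ω, g (tailStep b (tailProcess t (fun k => B k ω) n)) ∂P := fun b => by
    rw [← hχint b]
    exact ((indepFun_tailProcess hBmeas hBindep t n).comp
      (φ := fun c => if c = b then (1 : ℝ) else 0) (ψ := fun x => g (tailStep b x))
      (measurable_of_countable _) (hg.comp (measurable_tailStep b))).integral_fun_mul_eq_mul_integral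
      (hχmeas b).aestronglyMeasurable (hmeas b).aestronglyMeasurable
  have hintχ : ∀ b, Integrable
      (fun ω => χ b ω * g (tailStep b (tailProcess t (fun k => B k ω) n))) P := fun b =>
    Integrable.bdd_mul (c := 1) (hint b) (hχmeas b).aestronglyMeasurable
      (.of_forall fun ω => by simp only [χ]; split_ifs <;> simp)
  rw [integral_add (hint 0) (hint 1), mul_add, ← hprod, ← hprod,
    ← integral_add (hintχ 0) (hintχ 1)]
  refine integral_congr_ae (.of_forall fun ω => ?_)
  have h01 : ∀ c : Fin 2, c = 0 ∨ c = 1 := by decide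
  rcases h01 (B n ω) with h | h <;> simp [tailProcess, χ, h]

/-- The tails form a martingale, hence have constant mean. -/
lemma integral_tailProcess (hBmeas : ∀ n, Measurable (B n)) (hBindep : iIndepFun B P)
    (hBfair : ∀ n b, P {ω | B n ω = b} = 1 / 2) {t : ℝ} (ht : t ∈ Set.Icc (0 : ℝ) 1) (n : ℕ) :
    ∫ ω, tailProcess t (fun k => B k ω) n ∂P = t := by
  induction n with
  | zero => simp [tailProcess]
  | succ n ih =>
    refine (integral_tailProcess_succ hBmeas hBindep hBfair ht (g := id) measurable_id (C := 1)
      (fun x hx => by rw [id, Real.norm_of_nonneg hx.1]; exact hx.2) n).trans ?_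
    have h : ∀ x : ℝ, id (tailStep 0 x) + id (tailStep 1 x) = 2 * x := fun x => by
      simp [tailStep]
    simp only [h]
    rw [integral_const_mul, ih]
    ring

lemma ae_exists_tendsto_tailProcess (hBmeas : ∀ n, Measurable (B n)) (hBindep : iIndepFun B P)
    (hBfair : ∀ n b, P {ω | B n ω = b} = 1 / 2) {t : ℝ} (ht : t ∈ Set.Icc (0 : ℝ) 1) :
    ∀ᵐ ω ∂P, ∃ l : ℝ, (l = 0 ∨ l = 1) ∧
      Tendsto (tailProcess t fun k => B k ω) atTop (𝓝 l) := by
  let z : ℝ → ℝ := fun x => √(x * (1 - x))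
  have hz : Measurable z := by fun_prop
  have hz1 : ∀ x ∈ Set.Icc (0 : ℝ) 1, ‖z x‖ ≤ 1 := fun x hx => by
    rw [Real.norm_of_nonneg (Real.sqrt_nonneg _)]
    exact Real.sqrt_le_one.mpr (by nlinarith [hx.1, hx.2])
  let Z : ℕ → Ω → ℝ := fun n ω => z (tailProcess t (fun k => B k ω) n)
  have hZmeas : ∀ n, Measurable (Z n) := fun n => hz.comp (measurable_tailProcess hBmeas t n)
  have hZ0 : ∀ n ω, 0 ≤ Z n ω := fun n ω => Real.sqrt_nonneg _
  have hmem : ∀ n ω, tailProcess t (fun k => B k ω) n ∈ Set.Icc (0 : ℝ) 1 := fun n ω =>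
    tailProcess_mem_Icc ht _ n
  have hZint : ∀ n, Integrable (Z n) P := fun n =>
    Integrable.of_bound (hZmeas n).aestronglyMeasurable 1 (.of_forall fun ω => hz1 _ (hmem n ω))
  have hle : ∀ n, ∫ ω, Z n ω ∂P ≤ (√3 / 2) ^ n := fun n => by
    induction n with
    | zero =>
      have h := integral_mono (hZint 0) (integrable_const (1 : ℝ)) fun ω =>
        (Real.le_norm_self _).trans (hz1 _ (hmem 0 ω))
      simpa using h
    | succ n ih =>
      have h := integral_tailProcess_succ hBmeas hBindep hBfair ht hz hz1 n
      have hmono : ∫ ω, (z (tailStep 0 (tailProcess t (fun k => B k ω) n)) +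
          z (tailStep 1 (tailProcess t (fun k => B k ω) n))) ∂P ≤ ∫ ω, √3 * Z n ω ∂P :=
        integral_mono_of_nonneg
          (.of_forall fun ω => add_nonneg (Real.sqrt_nonneg _) (Real.sqrt_nonneg _))
          ((hZint n).const_mul _) (.of_forall fun ω => sqrt_tailStep_add_le (hmem n ω))
      rw [integral_const_mul] at hmono
      change ∫ ω, z (tailProcess t (fun k => B k ω) (n + 1)) ∂P ≤ _
      rw [h, pow_succ]
      nlinarith [Real.sqrt_nonneg 3]
  have hr : √3 / 2 < 1 := by
    rw [div_lt_one two_pos, Real.sqrt_lt' two_pos]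
    norm_num
  have hgeom := summable_geometric_of_lt_one (by positivity) hr
  have htsum : ∫⁻ ω, ∑' n, ENNReal.ofReal (Z n ω) ∂P ≠ ∞ := by
    rw [lintegral_tsum fun n => (hZmeas n).ennreal_ofReal.aemeasurable]
    refine ne_top_of_le_ne_top hgeom.tsum_ofReal_ne_top (ENNReal.tsum_le_tsum fun n => ?_)
    rw [← ofReal_integral_eq_lintegral_ofReal (hZint n) (.of_forall (hZ0 n))]
    exact ENNReal.ofReal_le_ofReal (hle n)
  filter_upwards [ae_lt_top' (AEMeasurable.tsum fun n =>
    (hZmeas n).ennreal_ofReal.aemeasurable) htsum] with ω hω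
  refine tendsto_tailProcess_of_summable ht _ ((ENNReal.summable_toReal hω.ne).congr fun n => ?_)
  exact ENNReal.toReal_ofReal (hZ0 n ω)

variable {ι : Type*} [LinearOrder ι] [Fintype ι]

/-- Almost surely, the probability vectors converge to a vertex of the simplex. -/
lemma ae_exists_tendsto_vecProcess (hBmeas : ∀ n, Measurable (B n)) (hBindep : iIndepFun B P)
    (hBfair : ∀ n b, P {ω | B n ω = b} = 1 / 2) (e : stdSimplex ℝ ι) :
    ∀ᵐ ω ∂P, ∃ v : stdSimplex ℝ ι, (∀ i, v.1 i = 0 ∨ v.1 i = 1) ∧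
      Tendsto (vecProcess e fun k => B k ω) atTop (𝓝 v) := by
  classical
  have h : ∀ᵐ ω ∂P, ∀ s : Finset ι, ∃ l : ℝ, (l = 0 ∨ l = 1) ∧
      Tendsto (tailProcess (∑ i ∈ s, e.1 i) fun k => B k ω) atTop (𝓝 l) :=
    ae_all_iff.mpr fun s => ae_exists_tendsto_tailProcess hBmeas hBindep hBfair (sum_mem_Icc e s)
  filter_upwards [h] with ω hω
  have hcoord : ∀ i, ∃ l : ℝ, (l = 0 ∨ l = 1) ∧
      Tendsto (fun n => (vecProcess e (fun k => B k ω) n).1 i) atTop (𝓝 l) := fun i => by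
    obtain ⟨l₁, h₁, hl₁⟩ := hω (Finset.univ.filter (i ≤ ·))
    obtain ⟨l₂, h₂, hl₂⟩ := hω (Finset.univ.filter (i < ·))
    have hlim : Tendsto (fun n => (vecProcess e (fun k => B k ω) n).1 i) atTop (𝓝 (l₁ - l₂)) := by
      simp only [vecProcess_apply]
      convert hl₁.sub hl₂
    have hnn : 0 ≤ l₁ - l₂ := ge_of_tendsto' hlim fun n => (vecProcess e _ n).2.1 i
    refine ⟨l₁ - l₂, ?_, hlim⟩
    revert hnn
    rcases h₁ with rfl | rfl <;> rcases h₂ with rfl | rfl <;> norm_num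
  choose v hv hlim using hcoord
  have hlim' : Tendsto (fun n => (vecProcess e (fun k => B k ω) n).1) atTop (𝓝 v) :=
    tendsto_pi_nhds.mpr hlim
  exact ⟨⟨v, (isClosed_stdSimplex ℝ ι).mem_of_tendsto hlim'
    (.of_forall fun n => (vecProcess e _ n).2)⟩, hv, tendsto_subtype_rng.mpr hlim'⟩

lemma measurable_vecProcess (hBmeas : ∀ n, Measurable (B n)) (e : stdSimplex ℝ ι) (n : ℕ) :
    Measurable fun ω => vecProcess e (fun k => B k ω) n := by
  classical
  refine Measurable.subtype_mk (measurable_pi_lambda _ fun i => ?_)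
  simp only [vecProcess_apply]
  exact (measurable_tailProcess hBmeas _ n).sub (measurable_tailProcess hBmeas _ n)

lemma integral_vecProcess (hBmeas : ∀ n, Measurable (B n)) (hBindep : iIndepFun B P)
    (hBfair : ∀ n b, P {ω | B n ω = b} = 1 / 2) (e : stdSimplex ℝ ι) (n : ℕ) (i : ι) :
    ∫ ω, (vecProcess e (fun k => B k ω) n).1 i ∂P = e.1 i := by
  classical
  have hint : ∀ s : Finset ι,
      Integrable (fun ω => tailProcess (∑ i ∈ s, e.1 i) (fun k => B k ω) n) P := fun s =>
    Integrable.of_bound (measurable_tailProcess hBmeas _ n).aestronglyMeasurable 1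
      (.of_forall fun ω => by
        have h := tailProcess_mem_Icc (sum_mem_Icc e s) (fun k => B k ω) n
        rw [Real.norm_of_nonneg h.1]
        exact h.2)
  simp only [vecProcess_apply]
  rw [integral_sub (hint _) (hint _),
    integral_tailProcess hBmeas hBindep hBfair (sum_mem_Icc e _),
    integral_tailProcess hBmeas hBindep hBfair (sum_mem_Icc e _)]
  exact (vecProcess_apply e (fun _ => 0) 0 i).symm

/-- The limiting vertex is random with law `e`. -/
lemma exists_limit_vecProcess (hBmeas : ∀ n, Measurable (B n)) (hBindep : iIndepFun B P)
    (hBfair : ∀ n b, P {ω | B n ω = b} = 1 / 2) (e : stdSimplex ℝ ι) :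
    ∃ E : Ω → stdSimplex ℝ ι, Measurable E ∧
      (∀ᵐ ω ∂P, Tendsto (vecProcess e fun k => B k ω) atTop (𝓝 (E ω))) ∧
      (∀ᵐ ω ∂P, ∀ i, (E ω).1 i = 0 ∨ (E ω).1 i = 1) ∧
      ∀ i, P {ω | (E ω).1 i = 1} = ENNReal.ofReal (e.1 i) := by
  have hae := ae_exists_tendsto_vecProcess hBmeas hBindep hBfair e
  obtain ⟨E, hEmeas, hE⟩ := measurable_limit_of_tendsto_metrizable_ae
    (fun n => (measurable_vecProcess hBmeas e n).aemeasurable)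
    (hae.mono fun ω ⟨v, _, hv⟩ => ⟨v, hv⟩)
  have hvertex : ∀ᵐ ω ∂P, ∀ i, (E ω).1 i = 0 ∨ (E ω).1 i = 1 := by
    filter_upwards [hae, hE] with ω ⟨v, hv, hlim⟩ hEω
    rwa [tendsto_nhds_unique hEω hlim]
  refine ⟨E, hEmeas, hE, hvertex, fun i => ?_⟩
  have hcoord : Measurable fun ω => (E ω).1 i :=
    (measurable_pi_apply i).comp (measurable_subtype_coe.comp hEmeas)
  have hlim : Tendsto (fun n => ∫ ω, (vecProcess e (fun k => B k ω) n).1 i ∂P) atTop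
      (𝓝 (∫ ω, (E ω).1 i ∂P)) := by
    refine tendsto_integral_of_dominated_convergence (fun _ => 1) (fun n => ?_)
      (integrable_const _) (fun n => .of_forall fun ω => ?_) ?_
    · exact ((measurable_pi_apply i).comp (measurable_subtype_coe.comp
        (measurable_vecProcess hBmeas e n))).aestronglyMeasurable
    · rw [Real.norm_of_nonneg ((vecProcess e _ n).2.1 i)]
      simpa using (sum_mem_Icc (vecProcess e (fun k => B k ω) n) {i}).2
    · filter_upwards [hE] with ω hω
      exact tendsto_pi_nhds.mp (tendsto_subtype_rng.mp hω) i
  simp only [integral_vecProcess hBmeas hBindep hBfair] at hlim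
  have hmean : e.1 i = ∫ ω, (E ω).1 i ∂P := tendsto_nhds_unique tendsto_const_nhds hlim
  have hset : MeasurableSet {ω | (E ω).1 i = 1} := hcoord (measurableSet_singleton 1)
  have hind : (fun ω => (E ω).1 i) =ᵐ[P] {ω | (E ω).1 i = 1}.indicator 1 := by
    filter_upwards [hvertex] with ω hω
    rcases hω i with h | h <;> simp [Set.indicator, h]
  rw [hmean, integral_congr_ae hind, integral_indicator_one hset, measureReal_def,
    ENNReal.ofReal_toReal (measure_ne_top _ _)]

end Probability

end Polarization

theorem theorem2 {q : ℕ} [NeZero q] (hq : IsPrimePow q) (γ : (ZMod q)ˣ)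
    (ε : Polarization.ProbVec q)
    {Ω : Type*} [MeasurableSpace Ω] (P : Measure Ω) [IsProbabilityMeasure P]
    (B : ℕ → Ω → Fin 2) (hBmeas : ∀ n, Measurable (B n)) (hBindep : iIndepFun B P)
    (hBfair : ∀ n b, P {ω | B n ω = b} = 1 / 2) :
    ∃ E : Ω → Polarization.ProbVec q, Measurable E ∧
      (∀ᵐ ω ∂P, Polarization.ConvergesTo γ
        (Polarization.Channel.process γ (Polarization.erasureChannel ε) (fun n => B n ω))
        (E ω)) ∧
      ∀ d : {d : ℕ // d ∈ q.divisors},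
        P {ω | ∀ α : ℝ≥0∞, (Polarization.erasureChannel (E ω)).symCap α = Real.log (d : ℕ)} =
          ENNReal.ofReal (ε.1 d) := by
  obtain ⟨E, hEmeas, hE, hvertex, hlaw⟩ :=
    Polarization.exists_limit_vecProcess hBmeas hBindep hBfair ε
  refine ⟨E, hEmeas, hE.mono fun ω hω => ⟨_, fun n =>
    (Polarization.Channel.likelihoodEquiv_process γ hq ε _ n).equivalent γ, hω⟩, fun d => ?_⟩
  rw [← hlaw d]
  refine measure_congr ?_
  filter_upwards [hvertex] with ω hω
  refine propext ⟨fun h => ?_, fun h α =>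
    Polarization.Channel.symCap_erasureChannel_of_eq_one _ d h α⟩
  -- A vertex of the simplex determines the common value `ln d'` of the capacities, hence `d'`.
  obtain ⟨d', hd'⟩ : ∃ d', (E ω).1 d' = 1 := by
    by_contra hne
    push Not at hne
    have hsum := (E ω).2.2
    rw [Finset.sum_eq_zero fun d' _ => (hω d').resolve_right (hne d')] at hsum
    exact zero_ne_one hsum
  have hlog := (Polarization.Channel.symCap_erasureChannel_of_eq_one _ d' hd' 0).symm.trans (h 0)
  have hpos : ∀ k : {d : ℕ // d ∈ q.divisors}, (0 : ℝ) < (k.1 : ℕ) := fun k =>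
    Nat.cast_pos.mpr (Nat.pos_of_mem_divisors k.2)
  have heq : d' = d := Subtype.ext (Nat.cast_injective
    (Real.log_injOn_pos (hpos d') (hpos d) hlog))
  exact heq ▸ hd'
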